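/- A rectangular warehouse has $n$ vertical aisles with horizontal coordinates $x_1<\dots<x_n$ and $b+1$ horizontal cross-aisles with vertical coordinates $y_0<\dots<y_b$ (so $b$ blocks); the subaisle $k$ of an aisle is its segment between cross-aisles $k-1$ and $k$. A finite set of item locations is given, each in the interior of a subaisle, together with a depot, which is either an intersection of an aisle with a cross-aisle or one of the item locations. The pick locations are the items and the depot; an aisle is non-empty if it contains at least one pick location. Let $G$ be the graph whose vertices are all intersections and all item locations, and whose edges are the segments joining consecutive vertices of one aisle and the segments joining the intersections of one cross-aisle with consecutive aisles, each edge weighted by its length. A minimal tour is a closed walk in $G$ of minimum total length through all pick locations, regarded as the multiset $T$ of edges that it traverses. A double edge of $T$ is a segment of an aisle between two different cross-aisles (thus spanning one or more subaisles) all of whose edges are contained at least twice in $T$, such that no horizontal edge of $T$ is incident to an intersection strictly inside the segment. (Horizontal edges used twice, and subaisles of which only a part is traversed twice, are not double edges.) Then a minimal tour without any double edge exists in each of the following two cases: (i) single-block layouts ($b=1$), with any number of non-empty aisles; (ii) two-block layouts ($b=2$) with at least two non-empty aisles. -/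

import Mathlib

/-!
A rectangular warehouse with `n` vertical aisles and `b` blocks, i.e. `b + 1` horizontal
cross-aisles `0, …, b` numbered from the top.  Points of the warehouse carry two coordinates:
the horizontal coordinate of their aisle and their distance down the aisle.  The subaisle `k` of
an aisle is the segment between the cross-aisles `k` and `k + 1`.
-/

namespace Picker

/-- The floor plan and the pick list of a rectangular warehouse: the aisles have horizontal
coordinates `aislePos`, the cross-aisles have vertical coordinates `crossPos`, and `items i k` is
the finite set of vertical coordinates of the pick locations inside subaisle `k` of aisle `i`. -/
structure Layout (n b : ℕ) where
  aislePos : Fin n → ℝ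
  aislePos_strictMono : StrictMono aislePos
  crossPos : Fin (b + 1) → ℝ
  crossPos_strictMono : StrictMono crossPos
  items : Fin n → Fin b → Finset ℝ
  items_mem : ∀ i k, ∀ p ∈ items i k, crossPos k.castSucc < p ∧ p < crossPos k.succ

namespace Layout

variable {n b : ℕ}

/-- The vertices of the warehouse graph: the intersections of aisles with cross-aisles,
and the pick locations inside the subaisles. -/
inductive Vertex (L : Layout n b) : Type
  | cross (i : Fin n) (r : Fin (b + 1)) : Vertex L
  | item (i : Fin n) (k : Fin b) (p : ℝ) (hp : p ∈ L.items i k) : Vertex L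

/-- The aisle in which a vertex lies. -/
def Vertex.aisle {L : Layout n b} : L.Vertex → Fin n
  | .cross i _ => i
  | .item i _ _ _ => i

/-- The vertical coordinate of a vertex. -/
def Vertex.pos {L : Layout n b} : L.Vertex → ℝ
  | .cross _ r => L.crossPos r
  | .item _ _ p _ => p

/-- `u` and `v` are consecutive vertices of the same aisle, `u` above `v`. -/
def VertStep (L : Layout n b) (u v : L.Vertex) : Prop :=
  u.aisle = v.aisle ∧ u.pos < v.pos ∧
    ∀ x : L.Vertex, x.aisle = u.aisle → ¬ (u.pos < x.pos ∧ x.pos < v.pos)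

/-- `u` and `v` are the intersections of one cross-aisle with two consecutive aisles,
`u` to the left of `v`. -/
def HorizStep (L : Layout n b) (u v : L.Vertex) : Prop :=
  ∃ (i j : Fin n) (r : Fin (b + 1)), i.val + 1 = j.val ∧ u = .cross i r ∧ v = .cross j r

/-- The warehouse graph. -/
def graph (L : Layout n b) : SimpleGraph L.Vertex :=
  SimpleGraph.fromRel fun u v => L.VertStep u v ∨ L.HorizStep u v

/-- The length of an edge.  Edges are horizontal or vertical segments,
so this is the length of the segment. -/
noncomputable def edgeLength (L : Layout n b) : Sym2 L.Vertex → ℝ :=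
  Sym2.lift ⟨fun u v => |L.aislePos u.aisle - L.aislePos v.aisle| + |u.pos - v.pos|,
    fun u v => by simp only [abs_sub_comm]⟩

end Layout

/-- A rectangular warehouse with a pick list and a depot.  The depot is one of the vertices;
it is the only location to be visited that may lie at an intersection. -/
structure Warehouse (n b : ℕ) extends Layout n b where
  depot : toLayout.Vertex

namespace Warehouse

variable {n b : ℕ}

/-- The locations that have to be visited: the depot and all items on the pick list. -/
def IsPickLocation (W : Warehouse n b) (v : W.Vertex) : Prop :=
  v = W.depot ∨ ∃ i k p, ∃ hp : p ∈ W.items i k, v = .item i k p hp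

/-- An aisle is non-empty if it contains at least one pick location. -/
def NonemptyAisle (W : Warehouse n b) (i : Fin n) : Prop :=
  ∃ v : W.Vertex, W.IsPickLocation v ∧ v.aisle = i

/-- A tour subgraph, as a multiset of edges: it consists of the edges, counted with
multiplicity, traversed by a closed walk from the depot that visits all pick locations. -/
def IsTourSubgraph (W : Warehouse n b) (T : Multiset (Sym2 W.Vertex)) : Prop :=
  ∃ w : W.graph.Walk W.depot W.depot,
    (∀ v, W.IsPickLocation v → v ∈ w.support) ∧ T = (w.edges : Multiset (Sym2 W.Vertex))

/-- The total length of a multiset of edges. -/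
noncomputable def length (W : Warehouse n b) (T : Multiset (Sym2 W.Vertex)) : ℝ :=
  (T.map W.edgeLength).sum

/-- A minimal tour: a tour subgraph of minimum length. -/
def IsMinimalTour (W : Warehouse n b) (T : Multiset (Sym2 W.Vertex)) : Prop :=
  W.IsTourSubgraph T ∧ ∀ T', W.IsTourSubgraph T' → W.length T ≤ W.length T'

open Classical in
/-- `T` has a double edge in aisle `i` between the cross-aisles `r` and `s`: the whole segment
between them, which is one or more subaisles, is contained (at least) twice in `T`, and
no horizontal edge of `T` is incident to an intersection strictly in between. -/
def HasDoubleEdge (W : Warehouse n b) (T : Multiset (Sym2 W.Vertex))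
    (i : Fin n) (r s : Fin (b + 1)) : Prop :=
  r < s ∧
  (∀ u v : W.Vertex, W.VertStep u v → u.aisle = i →
    W.crossPos r ≤ u.pos → v.pos ≤ W.crossPos s → 2 ≤ T.count s(u, v)) ∧
  (∀ q : Fin (b + 1), r < q → q < s → ∀ v : W.Vertex,
    W.HorizStep (.cross i q) v ∨ W.HorizStep v (.cross i q) → s(.cross i q, v) ∉ T)

/-- `T` contains no double edge. -/
def NoDoubleEdge (W : Warehouse n b) (T : Multiset (Sym2 W.Vertex)) : Prop :=
  ∀ i r s, ¬ W.HasDoubleEdge T i r s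

end Warehouse

end Picker

/-! Closed walks are replaced by pretours: multisets of edges whose cuts are all even and which
connect the depot to every pick location. By Euler's theorem a shortest pretour is the edge multiset
of a minimal tour, and an edge that it uses twice is a bridge. Among the shortest pretours, fix one
with the fewest doubled subaisles (`IsOptimal`). A double edge contains a doubled subaisle, so it is
enough to exclude these.

The tool is an exchange (`IsOptimal.swap`). If subaisle `k` of aisle `i` is doubled and a horizontal
edge to aisle `j` is used at one end, then one copy of the subaisle and that edge are replaced by
the other two sides of the rectangle. Length, parity and connectivity survive. By minimality,
subaisle `k` of aisle `j` must now be doubled, so the doubled subaisle has moved sideways. Combined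
with parity at an outer cross-aisle, this shows that the outer end of a doubled subaisle is the
depot (`IsOptimal.cross_eq_depot`).

With one block both ends are outer, and the depot cannot be at both. With two blocks, no horizontal
edge touches the doubled subaisle (`IsOptimal.horiz_notMem`), and the other subaisle of the aisle is
not doubled. An edge of the latter used at most once is the only possible exit from the depot's part
of the aisle, so by parity it is unused and all pick locations lie in one aisle
(`IsShort.aisle_eq`). -/

namespace Picker

/-- A bounded, inhabited predicate on `ℕ` has a greatest element. -/
theorem exists_greatest_nat (P : ℕ → Prop) {m B : ℕ} (hm : P m) (hB : ∀ n, P n → n ≤ B) :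
    ∃ n, P n ∧ ∀ k, P k → k ≤ n := by
  classical
  exact ⟨Nat.findGreatest P B, Nat.findGreatest_spec (hB m hm) hm,
    fun k hk => Nat.le_findGreatest (hB k hk) hk⟩

/-! ### Even cuts and Euler's theorem -/

section Euler

variable {V : Type*}

/-- The coboundary of a `ZMod 2`-valued function on the vertices. -/
def coboundary (χ : V → ZMod 2) : Sym2 V → ZMod 2 :=
  Sym2.lift ⟨fun a b => χ a + χ b, fun _ _ => add_comm _ _⟩

@[simp]
theorem coboundary_mk (χ : V → ZMod 2) (a b : V) : coboundary χ s(a, b) = χ a + χ b := rfl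

theorem mem_of_coboundary_single_ne_zero [DecidableEq V] {v : V} {e : Sym2 V}
    (he : coboundary (Pi.single v 1) e ≠ 0) : v ∈ e := by
  induction e with | _ a b
  by_contra hv
  simp only [Sym2.mem_iff, not_or] at hv
  simp [Pi.single_eq_of_ne' hv.1, Pi.single_eq_of_ne' hv.2] at he

theorem sum_coboundary_edges {G : SimpleGraph V} (χ : V → ZMod 2) {u v : V} (w : G.Walk u v) :
    ((w.edges : Multiset (Sym2 V)).map (coboundary χ)).sum = χ u + χ v := by
  induction w with
  | nil => simp [CharTwo.add_self_eq_zero]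
  | @cons a b c h p ih =>
    simp only [SimpleGraph.Walk.edges_cons, ← Multiset.cons_coe, Multiset.map_cons,
      Multiset.sum_cons, ih, coboundary_mk]
    rw [add_assoc, ← add_assoc (χ b), CharTwo.add_self_eq_zero, zero_add]

theorem mem_iff_of_walk {G : SimpleGraph V} {S : Set V} {u v : V} (w : G.Walk u v)
    (hS : ∀ a b, s(a, b) ∈ w.edges → a ∈ S → b ∈ S) : u ∈ S ↔ v ∈ S := by
  induction w with
  | nil => rfl
  | @cons a b c h p ih =>
    rw [← ih fun x y hxy => hS x y (by simp [hxy])]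
    exact ⟨hS a b (by simp), hS b a (by simp [Sym2.eq_swap])⟩

/-- All cuts of the multiset `T` of edges of `G` are even, and every set containing `d` that is
closed under the edges of `T` contains `P`. -/
structure IsPretour (G : SimpleGraph V) (d : V) (P : Set V) (T : Multiset (Sym2 V)) : Prop where
  mem_edgeSet : ∀ e ∈ T, e ∈ G.edgeSet
  even : ∀ χ, (T.map (coboundary χ)).sum = 0
  subset : ∀ S : Set V, d ∈ S → (∀ a b, s(a, b) ∈ T → a ∈ S → b ∈ S) → P ⊆ S

theorem isPretour_edges {G : SimpleGraph V} {d : V} {P : Set V} (w : G.Walk d d)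
    (hP : ∀ v ∈ P, v ∈ w.support) : IsPretour G d P (w.edges : Multiset (Sym2 V)) where
  mem_edgeSet e he := w.edges_subset_edgeSet (by simpa using he)
  even χ := by rw [sum_coboundary_edges, CharTwo.add_self_eq_zero]
  subset S hd hS v hv := by
    classical
    refine (mem_iff_of_walk (w.takeUntil v (hP v hv)) fun a b hab => hS a b ?_).1 hd
    exact Multiset.mem_coe.2 (w.edges_takeUntil_subset_edges _ hab)

/-- A longest walk from `u` with edges in `T` must be closed: if it ended at `v ≠ u`, parity at `v`
would leave an unused edge there to extend it. The competitors include the walk of length one, so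
the result is nontrivial. -/
theorem exists_closed_walk {G : SimpleGraph V} {T : Multiset (Sym2 V)}
    (hG : ∀ e ∈ T, e ∈ G.edgeSet) (heven : ∀ χ, (T.map (coboundary χ)).sum = 0) {u x : V}
    (hux : s(u, x) ∈ T) :
    ∃ c : G.Walk u u, 0 < c.length ∧ (c.edges : Multiset (Sym2 V)) ≤ T := by
  classical
  have hadj : G.Adj u x := hG _ hux
  have hone : ∃ v, ∃ w : G.Walk u v, w.length = 1 ∧ (w.edges : Multiset (Sym2 V)) ≤ T :=
    ⟨x, .cons hadj .nil, by simp, by simpa using hux⟩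
  obtain ⟨n, ⟨v, w, hw, hwT⟩, hmax⟩ := exists_greatest_nat
    (fun n => ∃ v, ∃ w : G.Walk u v, w.length = n ∧ (w.edges : Multiset (Sym2 V)) ≤ T)
    (m := 1) (B := T.card) hone (by
      rintro n ⟨v, w, rfl, hw⟩
      simpa using Multiset.card_le_card hw)
  have h1 : 1 ≤ n := hmax 1 hone
  by_cases huv : u = v
  · subst huv
    exact ⟨w, by omega, hwT⟩
  obtain ⟨R, rfl⟩ := Multiset.le_iff_exists_add.1 hwT
  have hR := heven (Pi.single v 1)
  rw [Multiset.map_add, Multiset.sum_add, sum_coboundary_edges, Pi.single_eq_same,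
    Pi.single_eq_of_ne huv, zero_add] at hR
  obtain ⟨e, heR, he⟩ : ∃ e ∈ R, coboundary (Pi.single v 1) e ≠ 0 := by
    by_contra! h
    rw [Multiset.map_congr rfl h] at hR
    simp at hR
  obtain ⟨y, rfl⟩ := mem_of_coboundary_single_ne_zero he
  have hadj : G.Adj v y := hG _ (Multiset.mem_add.2 (.inr heR))
  have := hmax (n + 1) ⟨y, w.concat hadj, by simp [hw], by
    rw [SimpleGraph.Walk.edges_concat, List.concat_eq_append, ← Multiset.coe_add]
    simpa using heR⟩
  omega

/-- Euler's theorem: a pretour contains the edges of a closed walk through all its locations. -/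
theorem IsPretour.exists_walk {G : SimpleGraph V} {d : V} {P : Set V} {T : Multiset (Sym2 V)}
    (hT : IsPretour G d P T) :
    ∃ w : G.Walk d d, (∀ v ∈ P, v ∈ w.support) ∧ (w.edges : Multiset (Sym2 V)) ≤ T := by
  classical
  obtain ⟨n, ⟨w, hw, hwT⟩, hmax⟩ := exists_greatest_nat
    (fun n => ∃ w : G.Walk d d, w.length = n ∧ (w.edges : Multiset (Sym2 V)) ≤ T)
    (m := 0) (B := T.card) ⟨.nil, by simp, by simp⟩ (by
      rintro n ⟨w, rfl, hw⟩
      simpa using Multiset.card_le_card hw)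
  refine ⟨w, fun v hv => ?_, hwT⟩
  refine hT.subset {v | v ∈ w.support} w.start_mem_support (fun a b hab ha => ?_) hv
  by_contra hb
  obtain ⟨R, rfl⟩ := Multiset.le_iff_exists_add.1 hwT
  have habR : s(a, b) ∈ R := (Multiset.mem_add.1 hab).resolve_left fun h =>
    hb (w.snd_mem_support_of_mem_edges (by simpa using h))
  obtain ⟨c, hc, hcR⟩ := exists_closed_walk (G := G)
    (fun e he => hT.mem_edgeSet e (Multiset.mem_add.2 (.inr he))) (fun χ => by
      have := hT.even χ
      rwa [Multiset.map_add, Multiset.sum_add, sum_coboundary_edges,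
        CharTwo.add_self_eq_zero, zero_add] at this) habR
  -- The unused edges again have even cuts, so a closed walk `c` among them can be spliced into the
  -- longest walk at `a`.
  have hsplit := w.take_spec ha
  have hlen : (w.takeUntil a ha).length + (w.dropUntil a ha).length = n := by
    rw [← SimpleGraph.Walk.length_append, hsplit, hw]
  have hedges : (w.edges : Multiset (Sym2 V)) =
      (w.takeUntil a ha).edges + (w.dropUntil a ha).edges := by
    rw [Multiset.coe_add, ← SimpleGraph.Walk.edges_append, hsplit]
  have := hmax (n + c.length) ⟨((w.takeUntil a ha).append c).append (w.dropUntil a ha), by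
    simp only [SimpleGraph.Walk.length_append]
    omega, by
    rw [SimpleGraph.Walk.edges_append, SimpleGraph.Walk.edges_append, ← Multiset.coe_add,
      ← Multiset.coe_add, hedges, add_right_comm]
    gcongr⟩
  omega

open Classical in
/-- An edge of odd multiplicity in a cut is accompanied by another one. -/
theorem IsPretour.exists_odd_count {G : SimpleGraph V} {d : V} {P : Set V}
    {T : Multiset (Sym2 V)} (hT : IsPretour G d P T) {χ : V → ZMod 2} {e : Sym2 V}
    (he : coboundary χ e ≠ 0) (hodd : Odd (T.count e)) :
    ∃ e', e' ≠ e ∧ coboundary χ e' ≠ 0 ∧ Odd (T.count e') := by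
  by_contra! h
  have hsum := hT.even χ
  rw [Finset.sum_multiset_map_count, Finset.sum_eq_single e] at hsum
  · rw [nsmul_eq_mul, (ZMod.natCast_eq_one_iff_odd).2 hodd, one_mul] at hsum
    exact he hsum
  · intro e' _ hne
    by_cases h0 : coboundary χ e' = 0
    · rw [h0, smul_zero]
    · have := Nat.not_odd_iff_even.1 (h e' hne h0)
      rw [nsmul_eq_mul, (ZMod.natCast_eq_zero_iff_even).2 this, zero_mul]
  · intro hmem
    rw [Multiset.mem_toFinset] at hmem
    rw [Multiset.count_eq_zero_of_notMem hmem, zero_smul]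

/-- Two copies of an edge may be removed if this does not separate the locations from `d`. -/
theorem IsPretour.of_add_pair {G : SimpleGraph V} {d : V} {P : Set V}
    {T : Multiset (Sym2 V)} {e : Sym2 V} (hT : IsPretour G d P (T + {e, e}))
    (h : ∀ S : Set V, d ∈ S → (∀ a b, s(a, b) ∈ T → a ∈ S → b ∈ S) → P ⊆ S) :
    IsPretour G d P T where
  mem_edgeSet e he := hT.mem_edgeSet e (Multiset.mem_add.2 (.inl he))
  even χ := by
    have := hT.even χ
    rwa [Multiset.map_add, Multiset.sum_add, Multiset.insert_eq_cons, Multiset.map_cons,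
      Multiset.map_singleton, Multiset.sum_cons, Multiset.sum_singleton,
      CharTwo.add_self_eq_zero, add_zero] at this
  subset := h

open Classical in
theorem exists_eq_add_pair {T : Multiset (Sym2 V)} {e : Sym2 V} (h : 2 ≤ T.count e) :
    ∃ R, T = R + {e, e} := by
  obtain ⟨R, hR⟩ := Multiset.le_iff_exists_add.1 (Multiset.le_count_iff_replicate_le.1 h)
  exact ⟨R, by rw [hR, add_comm]; rfl⟩

end Euler

end Picker

namespace Picker

/-! ### Existence and properties of shortest pretours -/

section Shortest

variable {V : Type*} {G : SimpleGraph V} {d : V} {P : Set V} {T : Multiset (Sym2 V)}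
  {ℓ : Sym2 V → ℝ}

open Classical in
-- Removing two copies of an edge used at least three times keeps parity, and a remaining copy keeps
-- connectivity.
theorem IsPretour.exists_le_count_le_two (hT : IsPretour G d P T) :
    ∃ T' ≤ T, IsPretour G d P T' ∧ ∀ e, T'.count e ≤ 2 := by
  induction hn : T.card using Nat.strong_induction_on generalizing T with
  | _ n ih =>
    by_cases h : ∀ e, T.count e ≤ 2
    · exact ⟨T, le_rfl, hT, h⟩
    push Not at h
    obtain ⟨e, he⟩ := h
    obtain ⟨R, rfl⟩ := exists_eq_add_pair he.le
    have heR : e ∈ R := by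
      rw [← Multiset.one_le_count_iff_mem]
      simp only [Multiset.count_add, Multiset.insert_eq_cons, Multiset.count_cons_self,
        Multiset.count_singleton_self] at he
      omega
    have hR : IsPretour G d P R := hT.of_add_pair fun S hd hS =>
      hT.subset S hd fun a b hab => hS a b (by
        simp only [Multiset.mem_add, Multiset.insert_eq_cons, Multiset.mem_cons,
          Multiset.mem_singleton] at hab
        rcases hab with hab | hab | hab
        · exact hab
        · rwa [hab]
        · rwa [hab])
    obtain ⟨T', hT', h1, h2⟩ := ih R.card (by rw [← hn]; simp) hR rfl
    exact ⟨T', hT'.trans (Multiset.le_add_right _ _), h1, h2⟩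

/-- A pretour of minimum length with respect to the edge lengths `ℓ`. -/
structure IsShortest (G : SimpleGraph V) (d : V) (P : Set V) (ℓ : Sym2 V → ℝ)
    (T : Multiset (Sym2 V)) : Prop extends IsPretour G d P T where
  le : ∀ T', IsPretour G d P T' → (T.map ℓ).sum ≤ (T'.map ℓ).sum

theorem IsPretour.sum_nonneg_of_le (hT : IsPretour G d P T) (hℓ : ∀ e ∈ G.edgeSet, 0 < ℓ e)
    {R : Multiset (Sym2 V)} (hR : R ≤ T) : 0 ≤ (R.map ℓ).sum := by
  refine Multiset.sum_nonneg fun x hx => ?_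
  obtain ⟨e, he, rfl⟩ := Multiset.mem_map.1 hx
  exact (hℓ e (hT.mem_edgeSet e (Multiset.mem_of_le hR he))).le

/-- Multiplicities may be capped at 2 without increasing the length, which leaves finitely many
candidates; every edge taken twice gives one to start from. -/
theorem exists_isShortest [Finite V] (hℓ : ∀ e ∈ G.edgeSet, 0 < ℓ e)
    (hG : ∀ S : Set V, d ∈ S → (∀ a b, G.Adj a b → a ∈ S → b ∈ S) → P ⊆ S) :
    ∃ T, IsShortest G d P ℓ T := by
  classical
  have := Fintype.ofFinite V
  have hall : IsPretour G d P (2 • G.edgeFinset.val) := by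
    refine ⟨fun e he => ?_, fun χ => ?_, fun S hd hS => hG S hd fun a b hab => hS a b ?_⟩
    · simpa using Multiset.mem_of_mem_nsmul he
    · rw [Multiset.map_nsmul, Multiset.sum_nsmul, two_nsmul, CharTwo.add_self_eq_zero]
    · rw [Multiset.mem_nsmul]
      exact ⟨two_ne_zero, by simpa using hab⟩
  have key : ∀ T, IsPretour G d P T → (∀ e, T.count e ≤ 2) →
      T ∈ Set.Icc 0 (2 • (Finset.univ : Finset (Sym2 V)).val) := by
    refine fun T _ hT => ⟨Multiset.zero_le _, Multiset.le_iff_count.2 fun e => ?_⟩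
    rw [Multiset.count_nsmul, Multiset.count_univ]
    simpa using hT e
  obtain ⟨T₀, -, h1, h2⟩ := hall.exists_le_count_le_two
  obtain ⟨T, ⟨hT, -⟩, hmin⟩ := Set.exists_min_image
    {T : Multiset (Sym2 V) | IsPretour G d P T ∧ ∀ e, T.count e ≤ 2} (fun T => (T.map ℓ).sum)
    ((Set.finite_Icc _ _).subset fun T hT => key T hT.1 hT.2) ⟨T₀, h1, h2⟩
  refine ⟨T, hT, fun T' hT' => ?_⟩
  obtain ⟨T'', hle, h3, h4⟩ := hT'.exists_le_count_le_two
  refine (hmin T'' ⟨h3, h4⟩).trans ?_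
  obtain ⟨R, rfl⟩ := Multiset.le_iff_exists_add.1 hle
  rw [Multiset.map_add, Multiset.sum_add]
  have := hT'.sum_nonneg_of_le hℓ (Multiset.le_add_left R T'')
  linarith

theorem IsShortest.eq_of_le (hℓ : ∀ e ∈ G.edgeSet, 0 < ℓ e) (hT : IsShortest G d P ℓ T)
    {T' : Multiset (Sym2 V)} (hT' : IsPretour G d P T') (hle : T' ≤ T) : T' = T := by
  obtain ⟨R, rfl⟩ := Multiset.le_iff_exists_add.1 hle
  by_contra hne
  have hR : R ≠ 0 := fun h => hne (by rw [h, add_zero])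
  obtain ⟨e, he⟩ := Multiset.exists_mem_of_ne_zero hR
  obtain ⟨R', rfl⟩ := Multiset.exists_cons_of_mem he
  have h1 := hT.le _ hT'
  have h2 := hℓ e (hT.mem_edgeSet e (by simp))
  have h3 : 0 ≤ (R'.map ℓ).sum := hT.toIsPretour.sum_nonneg_of_le hℓ
    ((Multiset.le_cons_self _ _).trans (Multiset.le_add_left _ _))
  rw [Multiset.map_add, Multiset.sum_add, Multiset.map_cons, Multiset.sum_cons] at h1
  linarith

open Classical in
theorem IsShortest.count_le_two (hℓ : ∀ e ∈ G.edgeSet, 0 < ℓ e) (hT : IsShortest G d P ℓ T)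
    (e : Sym2 V) : T.count e ≤ 2 := by
  obtain ⟨T', hle, h1, h2⟩ := hT.exists_le_count_le_two
  exact hT.eq_of_le hℓ h1 hle ▸ h2 e

open Classical in
/-- An edge used twice by a shortest pretour is a bridge. -/
theorem IsShortest.not_subset_of_two_le_count (hℓ : ∀ e ∈ G.edgeSet, 0 < ℓ e)
    (hT : IsShortest G d P ℓ T) {e : Sym2 V} (he : 2 ≤ T.count e) :
    ¬ ∀ S : Set V, d ∈ S → (∀ a b, s(a, b) ∈ T → s(a, b) ≠ e → a ∈ S → b ∈ S) → P ⊆ S := by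
  intro h
  obtain ⟨R, rfl⟩ := exists_eq_add_pair he
  have hR : IsPretour G d P R := by
    refine hT.of_add_pair fun S hd hS => h S hd ?_
    intro a b hab hne
    refine hS a b ((Multiset.mem_add.1 hab).resolve_right fun h => hne ?_)
    simpa using h
  have := congrArg Multiset.card (hT.eq_of_le hℓ hR (Multiset.le_add_right _ _))
  rw [Multiset.card_add, Multiset.card_pair] at this
  omega

/-- The edges of the Eulerian walk form a pretour inside `T`, and positive lengths allow no proper
one. -/
theorem IsShortest.exists_walk (hℓ : ∀ e ∈ G.edgeSet, 0 < ℓ e) (hT : IsShortest G d P ℓ T) :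
    ∃ w : G.Walk d d, (∀ v ∈ P, v ∈ w.support) ∧ T = (w.edges : Multiset (Sym2 V)) := by
  obtain ⟨w, hw, hle⟩ := hT.toIsPretour.exists_walk
  exact ⟨w, hw, (hT.eq_of_le hℓ (isPretour_edges w hw) hle).symm⟩

end Shortest

end Picker

/-! ### Geometry of the floor plan -/

namespace Picker

namespace Layout

variable {n b : ℕ} {L : Layout n b}

instance : Finite L.Vertex := by
  refine Finite.of_surjective (fun x : (Fin n × Fin (b + 1)) ⊕
      (Σ i : Fin n, Σ k : Fin b, {p // p ∈ L.items i k}) =>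
    Sum.elim (fun y => Vertex.cross y.1 y.2)
      (fun y => Vertex.item y.1 y.2.1 y.2.2.1 y.2.2.2) x) ?_
  rintro (⟨i, r⟩ | ⟨i, k, p, hp⟩)
  · exact ⟨.inl (i, r), rfl⟩
  · exact ⟨.inr ⟨i, k, p, hp⟩, rfl⟩

theorem crossPos_notMem_Ioo (L : Layout n b) (r : Fin (b + 1)) (k : Fin b) :
    ¬ (L.crossPos k.castSucc < L.crossPos r ∧ L.crossPos r < L.crossPos k.succ) := by
  rw [L.crossPos_strictMono.lt_iff_lt, L.crossPos_strictMono.lt_iff_lt, Fin.lt_def, Fin.lt_def,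
    Fin.val_castSucc, Fin.val_succ]
  omega

/-- Items lie strictly inside their subaisles, so they meet neither intersections nor items of other
subaisles. Thus `pos` orders each aisle linearly. -/
theorem Vertex.ext_pos {u v : L.Vertex} (h1 : u.aisle = v.aisle) (h2 : u.pos = v.pos) :
    u = v := by
  rcases u with ⟨i, r⟩ | ⟨i, k, p, hp⟩ <;> rcases v with ⟨j, s⟩ | ⟨j, l, q, hq⟩ <;>
    simp only [Vertex.aisle, Vertex.pos] at h1 h2
  · rw [h1, L.crossPos_strictMono.injective h2]
  · exact absurd (h2 ▸ L.items_mem j l q hq) (L.crossPos_notMem_Ioo r l)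
  · exact absurd (h2 ▸ L.items_mem i k p hp) (L.crossPos_notMem_Ioo s k)
  · subst h1 h2
    have h3 := L.items_mem i k p hp
    have h4 := L.items_mem i l p hq
    have h5 := h3.1.trans h4.2
    have h6 := h4.1.trans h3.2
    rw [L.crossPos_strictMono.lt_iff_lt, Fin.lt_def, Fin.val_castSucc, Fin.val_succ] at h5 h6
    obtain rfl : k = l := Fin.ext (by omega)
    rfl

theorem VertStep.adj {u v : L.Vertex} (h : L.VertStep u v) : L.graph.Adj u v := by
  rw [graph, SimpleGraph.fromRel_adj]
  exact ⟨fun huv => h.2.1.ne (by rw [huv]), .inl (.inl h)⟩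

theorem VertStep.edgeLength_eq {u v : L.Vertex} (h : L.VertStep u v) :
    L.edgeLength s(u, v) = v.pos - u.pos := by
  simp only [edgeLength, Sym2.lift_mk, h.1, sub_self, abs_zero, zero_add]
  rw [abs_sub_comm, abs_of_pos (sub_pos.2 h.2.1)]

theorem VertStep.eq_of_mk_eq {a b u v : L.Vertex} (h : L.VertStep a b) (h' : L.VertStep u v)
    (he : s(a, b) = s(u, v)) : a = u ∧ b = v := by
  rcases Sym2.eq_iff.1 he with h1 | ⟨rfl, rfl⟩
  · exact h1
  · exact absurd h.2.1 h'.2.1.not_gt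

/-- The path down an aisle from `u` to `v`. -/
theorem exists_vertical_path (u v : L.Vertex) (huv : u.aisle = v.aisle) (hle : u.pos ≤ v.pos) :
    ∃ w : L.graph.Walk u v, w.IsPath ∧
      (∀ e, e ∈ w.edges ↔ ∃ a b, L.VertStep a b ∧ a.aisle = u.aisle ∧ u.pos ≤ a.pos ∧
        b.pos ≤ v.pos ∧ e = s(a, b)) ∧
      (w.edges.map L.edgeLength).sum = v.pos - u.pos ∧ ∀ x ∈ w.support, u.pos ≤ x.pos := by
  induction hm : {x : L.Vertex | x.aisle = u.aisle ∧ u.pos < x.pos}.ncard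
    using Nat.strong_induction_on generalizing u with
  | _ m ih =>
  rcases hle.eq_or_lt with heq | hlt
  · obtain rfl := Vertex.ext_pos huv heq
    refine ⟨.nil, .nil, fun e => ?_, by simp, by simp⟩
    simp only [SimpleGraph.Walk.edges_nil, List.not_mem_nil, false_iff]
    rintro ⟨a, b, h, -, h1, h2, -⟩
    exact absurd h.2.1 (by linarith)
  · obtain ⟨x, ⟨hx1, hx2⟩, hx⟩ := Set.exists_min_image
      {x : L.Vertex | x.aisle = u.aisle ∧ u.pos < x.pos} Vertex.pos (Set.toFinite _)
      ⟨v, huv.symm, hlt⟩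
    have hstep : L.VertStep u x :=
      ⟨hx1.symm, hx2, fun y hy h => (hx y ⟨hy, h.1⟩).not_gt h.2⟩
    have hxv : x.pos ≤ v.pos := hx v ⟨huv.symm, hlt⟩
    obtain ⟨w, h1, h2, h3, h4⟩ := ih _ (by
      rw [← hm]
      refine Set.ncard_lt_ncard ⟨fun y hy => ⟨hy.1.trans hx1, hx2.trans hy.2⟩, fun h => ?_⟩
      exact lt_irrefl _ (h ⟨hx1, hx2⟩ : x.aisle = x.aisle ∧ x.pos < x.pos).2) x
      (hx1.trans huv) hxv rfl
    refine ⟨.cons hstep.adj w, ?_, fun e => ?_, ?_, ?_⟩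
    · rw [SimpleGraph.Walk.cons_isPath_iff]
      exact ⟨h1, fun h => (h4 u h).not_gt hx2⟩
    · rw [SimpleGraph.Walk.edges_cons, List.mem_cons, h2]
      constructor
      · rintro (rfl | ⟨a, b, h, h5, h6, h7, rfl⟩)
        · exact ⟨u, x, hstep, rfl, le_rfl, hxv, rfl⟩
        · exact ⟨a, b, h, h5.trans hx1, hx2.le.trans h6, h7, rfl⟩
      · rintro ⟨a, b, h, h5, h6, h7, rfl⟩
        rcases h6.eq_or_lt with h8 | h8
        · obtain rfl := Vertex.ext_pos h5.symm h8
          left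
          have h9 := hx b ⟨h.1.symm, h.2.1⟩
          rcases h9.eq_or_lt with h10 | h10
          · rw [Vertex.ext_pos (hx1.trans h.1) h10]
          · exact absurd ⟨hx2, h10⟩ (h.2.2 x hx1)
        · exact .inr ⟨a, b, h, h5.trans hx1.symm, hx a ⟨h5, h8⟩, h7, rfl⟩
    · rw [SimpleGraph.Walk.edges_cons, List.map_cons, List.sum_cons, h3, hstep.edgeLength_eq]
      ring
    · intro y hy
      rw [SimpleGraph.Walk.support_cons, List.mem_cons] at hy
      rcases hy with rfl | hy
      · exact le_rfl
      · exact hx2.le.trans (h4 y hy)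

/-- The edges of subaisle `k` of aisle `i`. -/
noncomputable def segment (L : Layout n b) (i : Fin n) (k : Fin b) : Finset (Sym2 L.Vertex) :=
  {e | ∃ u v, L.VertStep u v ∧ u.aisle = i ∧ L.crossPos k.castSucc ≤ u.pos ∧
    v.pos ≤ L.crossPos k.succ ∧ e = s(u, v)}.toFinite.toFinset

theorem mem_segment {i : Fin n} {k : Fin b} {e : Sym2 L.Vertex} : e ∈ L.segment i k ↔
    ∃ u v, L.VertStep u v ∧ u.aisle = i ∧ L.crossPos k.castSucc ≤ u.pos ∧
      v.pos ≤ L.crossPos k.succ ∧ e = s(u, v) := by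
  simp [segment]

/-- The edge of cross-aisle `r` between the aisles `i` and `j`. -/
def horiz (L : Layout n b) (i j : Fin n) (r : Fin (b + 1)) : Sym2 L.Vertex :=
  s(.cross i r, .cross j r)

/-- `i` and `j` are consecutive aisles. -/
def Consecutive (i j : Fin n) : Prop := i.val + 1 = j.val ∨ j.val + 1 = i.val

theorem Consecutive.symm {i j : Fin n} (h : Consecutive i j) : Consecutive j i := Or.symm h

theorem Consecutive.ne {i j : Fin n} (h : Consecutive i j) : i ≠ j := by
  rintro rfl
  rcases h with h | h <;> omega

/-- Subaisle `k` has the ends `r` and `r'`. -/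
def IsEnds (k : Fin b) (r r' : Fin (b + 1)) : Prop :=
  r = k.castSucc ∧ r' = k.succ ∨ r = k.succ ∧ r' = k.castSucc

theorem IsEnds.symm {k : Fin b} {r r' : Fin (b + 1)} (h : IsEnds k r r') : IsEnds k r' r := by
  rcases h with ⟨h1, h2⟩ | ⟨h1, h2⟩
  · exact .inr ⟨h2, h1⟩
  · exact .inl ⟨h2, h1⟩

theorem IsEnds.ne {k : Fin b} {r r' : Fin (b + 1)} (h : IsEnds k r r') : r ≠ r' := by
  rintro rfl
  rcases h with ⟨h1, h2⟩ | ⟨h1, h2⟩ <;>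
    exact absurd (congrArg Fin.val (h1.symm.trans h2)) (by simp)

theorem horiz_comm (L : Layout n b) (i j : Fin n) (r : Fin (b + 1)) :
    L.horiz i j r = L.horiz j i r := Sym2.eq_swap

theorem horiz_ne_horiz (L : Layout n b) {i j i' j' : Fin n} {r r' : Fin (b + 1)} (h : r ≠ r') :
    L.horiz i j r ≠ L.horiz i' j' r' := by
  intro he
  rcases Sym2.eq_iff.1 he with ⟨h1, -⟩ | ⟨h1, -⟩ <;> exact h (Vertex.cross.inj h1).2

theorem horiz_adj (L : Layout n b) {i j : Fin n} (h : Consecutive i j) (r : Fin (b + 1)) :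
    L.graph.Adj (.cross i r) (.cross j r) := by
  rw [graph, SimpleGraph.fromRel_adj]
  refine ⟨fun he => h.ne (Vertex.cross.inj he).1, ?_⟩
  rcases h with h | h
  · exact .inl (.inr ⟨i, j, r, h, rfl, rfl⟩)
  · exact .inr (.inr ⟨j, i, r, h, rfl, rfl⟩)

theorem edgeLength_horiz (L : Layout n b) (i j : Fin n) (r : Fin (b + 1)) :
    L.edgeLength (L.horiz i j r) = |L.aislePos i - L.aislePos j| := by
  simp [edgeLength, horiz, Vertex.aisle, Vertex.pos]

theorem exists_segment_path (L : Layout n b) (i : Fin n) {k : Fin b} {r r' : Fin (b + 1)}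
    (h : IsEnds k r r') :
    ∃ w : L.graph.Walk (.cross i r) (.cross i r'), w.IsPath ∧
      (w.edges : Multiset (Sym2 L.Vertex)) = (L.segment i k).val ∧
      (w.edges.map L.edgeLength).sum = L.crossPos k.succ - L.crossPos k.castSucc := by
  obtain ⟨w, h1, h2, h4, -⟩ := exists_vertical_path (.cross i k.castSucc : L.Vertex)
    (.cross i k.succ) rfl (L.crossPos_strictMono.monotone k.castSucc_lt_succ.le)
  have h3 : (w.edges : Multiset (Sym2 L.Vertex)) = (L.segment i k).val := by
    rw [Multiset.Nodup.ext (Multiset.coe_nodup.2 h1.isTrail.edges_nodup) (Finset.nodup _)]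
    intro e
    rw [Multiset.mem_coe, h2, Finset.mem_val, mem_segment]
    rfl
  rcases h with ⟨rfl, rfl⟩ | ⟨rfl, rfl⟩
  · exact ⟨w, h1, h3, h4⟩
  · refine ⟨w.reverse, h1.reverse, ?_, ?_⟩
    · rw [SimpleGraph.Walk.edges_reverse, Multiset.coe_reverse, h3]
    · rw [SimpleGraph.Walk.edges_reverse, List.map_reverse, List.sum_reverse, h4]
      rfl

theorem sum_edgeLength_segment (L : Layout n b) (i : Fin n) (k : Fin b) :
    ((L.segment i k).val.map L.edgeLength).sum = L.crossPos k.succ - L.crossPos k.castSucc := by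
  obtain ⟨w, -, h1, h2⟩ := L.exists_segment_path i (.inl ⟨rfl, rfl⟩ : IsEnds k _ _)
  rw [← h1, Multiset.map_coe, Multiset.sum_coe, h2]

/-- Supplies an edge to test multiplicities on; being doubled is never a vacuous condition. -/
theorem segment_nonempty (L : Layout n b) (i : Fin n) (k : Fin b) : (L.segment i k).Nonempty := by
  rw [Finset.nonempty_iff_ne_empty]
  intro h
  have := L.sum_edgeLength_segment i k
  rw [h] at this
  have h2 := L.crossPos_strictMono k.castSucc_lt_succ
  simp at this
  linarith

theorem eq_of_mem_segment {i j : Fin n} {k l : Fin b} {e : Sym2 L.Vertex}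
    (h : e ∈ L.segment i k) (h' : e ∈ L.segment j l) : i = j ∧ k = l := by
  obtain ⟨u, v, huv, rfl, h1, h2, rfl⟩ := mem_segment.1 h
  obtain ⟨a, c, hac, rfl, h3, h4, he⟩ := mem_segment.1 h'
  obtain ⟨rfl, rfl⟩ := huv.eq_of_mk_eq hac he
  refine ⟨rfl, ?_⟩
  have h5 := (h1.trans_lt huv.2.1).trans_le h4
  have h6 := (h3.trans_lt huv.2.1).trans_le h2
  rw [L.crossPos_strictMono.lt_iff_lt, Fin.lt_def, Fin.val_castSucc, Fin.val_succ] at h5 h6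
  exact Fin.ext (by omega)

theorem horiz_notMem_segment {i j l : Fin n} {r : Fin (b + 1)} {k : Fin b} (h : i ≠ j) :
    L.horiz i j r ∉ L.segment l k := by
  intro hmem
  obtain ⟨u, v, huv, -, -, -, he⟩ := mem_segment.1 hmem
  rcases Sym2.eq_iff.1 he with ⟨rfl, rfl⟩ | ⟨rfl, rfl⟩
  · exact h huv.1
  · exact h huv.1.symm

theorem Vertex.pos_le_last (v : L.Vertex) : v.pos ≤ L.crossPos (Fin.last b) := by
  rcases v with ⟨j, s⟩ | ⟨j, l, q, hq⟩
  · exact L.crossPos_strictMono.monotone (Fin.le_last s)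
  · exact (L.items_mem j l q hq).2.le.trans (L.crossPos_strictMono.monotone (Fin.le_last _))

theorem VertStep.exists_mem_segment {u v : L.Vertex} (h : L.VertStep u v) :
    ∃ k, s(u, v) ∈ L.segment u.aisle k := by
  suffices ∃ k : Fin b, L.crossPos k.castSucc ≤ u.pos ∧ u.pos < L.crossPos k.succ by
    obtain ⟨k, h1, h2⟩ := this
    refine ⟨k, mem_segment.2 ⟨u, v, h, rfl, h1, ?_, rfl⟩⟩
    by_contra! h3
    exact h.2.2 (.cross u.aisle k.succ) rfl ⟨h2, h3⟩
  rcases u with ⟨j, s⟩ | ⟨j, l, q, hq⟩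
  · have hs : s ≠ Fin.last b := by
      rintro rfl
      exact absurd h.2.1 v.pos_le_last.not_gt
    refine ⟨s.castPred hs, ?_, ?_⟩
    · exact le_of_eq rfl
    · refine L.crossPos_strictMono ?_
      rw [Fin.lt_def]
      simp
  · exact ⟨l, (L.items_mem j l q hq).1.le, (L.items_mem j l q hq).2⟩

theorem mem_edgeSet_graph {e : Sym2 L.Vertex} (he : e ∈ L.graph.edgeSet) :
    (∃ i k, e ∈ L.segment i k) ∨ ∃ i j r, Consecutive i j ∧ e = L.horiz i j r := by
  induction e with | _ u v
  rw [SimpleGraph.mem_edgeSet, graph, SimpleGraph.fromRel_adj] at he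
  rcases he.2 with (h | ⟨i, j, r, h, rfl, rfl⟩) | (h | ⟨i, j, r, h, rfl, rfl⟩)
  · obtain ⟨k, hk⟩ := h.exists_mem_segment
    exact .inl ⟨_, k, hk⟩
  · exact .inr ⟨i, j, r, .inl h, rfl⟩
  · obtain ⟨k, hk⟩ := h.exists_mem_segment
    exact .inl ⟨_, k, by rwa [Sym2.eq_swap]⟩
  · exact .inr ⟨j, i, r, .inr h, rfl⟩

theorem edgeLength_pos {e : Sym2 L.Vertex} (he : e ∈ L.graph.edgeSet) : 0 < L.edgeLength e := by
  rcases mem_edgeSet_graph he with ⟨i, k, h⟩ | ⟨i, j, r, h, rfl⟩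
  · obtain ⟨u, v, huv, -, -, -, rfl⟩ := mem_segment.1 h
    rw [huv.edgeLength_eq]
    exact sub_pos.2 huv.2.1
  · rw [edgeLength_horiz, abs_pos, sub_ne_zero]
    exact fun he => h.ne (L.aislePos_strictMono.injective he)

theorem eq_of_cross_mem_segment {i j : Fin n} {k : Fin b} {r : Fin (b + 1)} {e : Sym2 L.Vertex}
    (he : e ∈ L.segment j k) (hr : Vertex.cross i r ∈ e) : i = j ∧ ∃ r', IsEnds k r r' := by
  obtain ⟨u, v, huv, rfl, h1, h2, rfl⟩ := mem_segment.1 he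
  have h3 : i = u.aisle ∧ L.crossPos k.castSucc ≤ L.crossPos r ∧
      L.crossPos r ≤ L.crossPos k.succ := by
    rcases Sym2.mem_iff.1 hr with rfl | rfl
    · exact ⟨rfl, h1, huv.2.1.le.trans h2⟩
    · exact ⟨huv.1.symm, h1.trans huv.2.1.le, h2⟩
  refine ⟨h3.1, ?_⟩
  have h4 := h3.2
  rw [L.crossPos_strictMono.le_iff_le, L.crossPos_strictMono.le_iff_le, Fin.le_def, Fin.le_def,
    Fin.val_castSucc, Fin.val_succ] at h4
  rcases (by omega : r.val = k.val ∨ r.val = k.val + 1) with h | h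
  · exact ⟨k.succ, .inl ⟨Fin.ext h, rfl⟩⟩
  · exact ⟨k.castSucc, .inr ⟨Fin.ext (by simpa using h), rfl⟩⟩

/-- Connectedness of the graph: every vertex reaches the last cross-aisle along its own aisle, and
that cross-aisle joins all aisles. -/
theorem mem_of_closed {S : Set L.Vertex} {u : L.Vertex} (hu : u ∈ S)
    (hS : ∀ a c, L.graph.Adj a c → a ∈ S → c ∈ S) (v : L.Vertex) : v ∈ S := by
  have hvert : ∀ x : L.Vertex, x ∈ S ↔ Vertex.cross x.aisle (Fin.last b) ∈ S := by
    intro x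
    obtain ⟨w, -⟩ := exists_vertical_path x (.cross x.aisle (Fin.last b)) rfl x.pos_le_last
    exact mem_iff_of_walk w fun a c hac => hS a c (w.adj_of_mem_edges hac)
  have hhoriz : ∀ (m : ℕ) (i j : Fin n), i.val + m = j.val →
      (Vertex.cross i (Fin.last b) ∈ S ↔ Vertex.cross j (Fin.last b) ∈ S) := by
    intro m
    induction m with
    | zero =>
      intro i j h
      rw [Fin.ext h]
    | succ m ih =>
      intro i j h
      have hadj := L.horiz_adj (i := ⟨i + m, by omega⟩) (j := j) (.inl (by omega)) (Fin.last b)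
      rw [ih i ⟨i + m, by omega⟩ rfl]
      exact ⟨hS _ _ hadj, hS _ _ hadj.symm⟩
  rw [hvert] at hu ⊢
  rcases le_total u.aisle v.aisle with h | h
  · exact (hhoriz (v.aisle - u.aisle) _ _ (by rw [Fin.le_def] at h; omega)).1 hu
  · exact (hhoriz (u.aisle - v.aisle) _ _ (by rw [Fin.le_def] at h; omega)).2 hu

end Layout

end Picker

/-! ### Doubled subaisles and the exchange along a rectangle -/

namespace Picker

namespace Layout

variable {n b : ℕ} {L : Layout n b}

theorem segment_subset_edgeSet {i : Fin n} {k : Fin b} {e : Sym2 L.Vertex}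
    (he : e ∈ L.segment i k) : e ∈ L.graph.edgeSet := by
  obtain ⟨u, v, huv, -, -, -, rfl⟩ := mem_segment.1 he
  exact huv.adj

theorem sum_coboundary_segment (L : Layout n b) (χ : L.Vertex → ZMod 2) (i : Fin n) {k : Fin b}
    {r r' : Fin (b + 1)} (h : IsEnds k r r') :
    ((L.segment i k).val.map (coboundary χ)).sum = χ (.cross i r) + χ (.cross i r') := by
  obtain ⟨w, -, hw, -⟩ := L.exists_segment_path i h
  rw [← hw, sum_coboundary_edges]

theorem cross_mem_iff_of_segment {S : Set L.Vertex} {i : Fin n} {k : Fin b}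
    {r r' : Fin (b + 1)} (h : IsEnds k r r')
    (hS : ∀ a c, s(a, c) ∈ L.segment i k → a ∈ S → c ∈ S) :
    Vertex.cross i r ∈ S ↔ Vertex.cross i r' ∈ S := by
  obtain ⟨w, -, hw, -⟩ := L.exists_segment_path i h
  refine mem_iff_of_walk w fun a c hac => hS a c ?_
  rwa [← Finset.mem_val, ← hw]

/-- The first edge of a subaisle, seen from its end `r`. -/
theorem exists_first_edge (L : Layout n b) (i : Fin n) {k : Fin b} {r r' : Fin (b + 1)}
    (h : IsEnds k r r') : ∃ (x : L.Vertex) (p : L.graph.Walk x (.cross i r')),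
      s(.cross i r, x) ∈ L.segment i k ∧
      (∀ e ∈ p.edges, e ∈ L.segment i k ∧ e ≠ s(.cross i r, x)) ∧
      ∀ e ∈ L.segment i k, .cross i r ∈ e → e = s(.cross i r, x) := by
  obtain ⟨w, hw, hE, -⟩ := L.exists_segment_path i h
  have hmem : ∀ e, e ∈ L.segment i k ↔ e ∈ w.edges := fun e => by
    rw [← Finset.mem_val, ← hE, Multiset.mem_coe]
  cases w with
  | nil => exact absurd rfl h.ne
  | @cons _ x _ hadj p =>
    have hp := (SimpleGraph.Walk.cons_isPath_iff _ _).1 hw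
    have hnot : ∀ e ∈ p.edges, Vertex.cross i r ∉ e := fun e he hr =>
      hp.2 (SimpleGraph.Walk.mem_support_of_mem_edges he hr)
    refine ⟨x, p, (hmem _).2 (by simp), fun e he => ⟨(hmem e).2 (by simp [he]), ?_⟩, ?_⟩
    · rintro rfl
      exact hnot _ he (Sym2.mem_mk_left _ _)
    · intro e he hr
      rw [hmem, SimpleGraph.Walk.edges_cons, List.mem_cons] at he
      exact he.resolve_right fun h => hnot e h hr

end Layout

namespace Warehouse

open Layout

variable {n b : ℕ} {W : Warehouse n b} {T : Multiset (Sym2 W.Vertex)}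

/-- Shortest pretours of a warehouse. -/
abbrev IsShort (W : Warehouse n b) (T : Multiset (Sym2 W.Vertex)) : Prop :=
  IsShortest W.graph W.depot {v | W.IsPickLocation v} W.edgeLength T

theorem isMinimalTour_of_isShort (hT : W.IsShort T) : W.IsMinimalTour T := by
  refine ⟨hT.exists_walk fun e => edgeLength_pos, ?_⟩
  rintro T' ⟨w, hw, rfl⟩
  exact hT.le _ (isPretour_edges w hw)

open Classical in
/-- The subaisles that are traversed twice by `T`. -/
def doubled (W : Warehouse n b) (T : Multiset (Sym2 W.Vertex)) : Set (Fin n × Fin b) :=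
  {x | ∀ e ∈ W.segment x.1 x.2, 2 ≤ T.count e}

/-- The topmost subaisle of the double edge serves; the condition on horizontal edges is not needed.
-/
theorem exists_mem_doubled (h : ¬ W.NoDoubleEdge T) : ∃ i k, (i, k) ∈ W.doubled T := by
  simp only [NoDoubleEdge, not_forall, not_not] at h
  obtain ⟨i, r, s, hrs, h, -⟩ := h
  refine ⟨i, r.castPred (ne_of_lt (hrs.trans_le (Fin.le_last s))), fun e he => ?_⟩
  obtain ⟨u, v, huv, hi, h1, h2, rfl⟩ := mem_segment.1 he
  refine h u v huv hi (by simpa using h1) (h2.trans (W.crossPos_strictMono.monotone ?_))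
  rw [Fin.lt_def] at hrs
  rw [Fin.le_def]
  simpa using hrs

/-- A shortest pretour with as few doubled subaisles as possible. -/
structure IsOptimal (W : Warehouse n b) (T : Multiset (Sym2 W.Vertex)) : Prop where
  isShort : W.IsShort T
  ncard_le : ∀ T', W.IsShort T' → (W.doubled T).ncard ≤ (W.doubled T').ncard

theorem exists_isOptimal (W : Warehouse n b) : ∃ T, W.IsOptimal T := by
  classical
  obtain ⟨T₀, hT₀⟩ : ∃ T, W.IsShort T := exists_isShortest (fun e => edgeLength_pos)
    fun S hd hS v _ => mem_of_closed hd hS v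
  have hex : ∃ m, ∃ T, W.IsShort T ∧ (W.doubled T).ncard = m := ⟨_, T₀, hT₀, rfl⟩
  obtain ⟨T, hT, hm⟩ := Nat.find_spec hex
  exact ⟨T, hT, fun T' hT' => hm.trans_le (Nat.find_min' hex ⟨T', hT', rfl⟩)⟩

/-- An end of a doubled subaisle without any other edges is the depot. -/
theorem IsShort.cross_eq_depot {i : Fin n} {k : Fin b} {r r' : Fin (b + 1)} (hT : W.IsShort T)
    (hd : (i, k) ∈ W.doubled T) (hr : IsEnds k r r') (hout : ∀ l s, IsEnds l r s → l = k)
    (hhor : ∀ j, Consecutive i j → W.horiz i j r ∉ T) : .cross i r = W.depot := by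
  classical
  by_contra hne
  obtain ⟨x, p, hx, hp, huniq⟩ := W.exists_first_edge i hr
  have hx0 : x ≠ .cross i r := 
    (SimpleGraph.mem_edgeSet _ |>.1 (segment_subset_edgeSet hx)).ne'
  refine hT.not_subset_of_two_le_count (fun e => edgeLength_pos) (hd _ hx)
    fun S hS hcl v hv => ?_
  -- The end is a dead end of `T`: its only edge is the first one of the doubled subaisle.
  have hinc : ∀ e ∈ T, .cross i r ∈ e → e = s(.cross i r, x) := by
    intro e he hie
    rcases mem_edgeSet_graph (hT.mem_edgeSet e he) with ⟨j, l, h⟩ | ⟨j, l, q, h, rfl⟩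
    · obtain ⟨rfl, s, hs⟩ := eq_of_cross_mem_segment h hie
      obtain rfl := hout _ _ hs
      exact huniq e h hie
    · exfalso
      rcases Sym2.mem_iff.1 hie with h1 | h1 <;> obtain ⟨rfl, rfl⟩ := Vertex.cross.inj h1
      · exact hhor _ h he
      · exact hhor _ h.symm (by rwa [horiz_comm])
  -- Reassigning the dead end to the side of its neighbour `x` makes `S` closed under all of `T`.
  -- Only the dead end may change sides, and it is not a pick location.
  have hsub := hT.subset {v | (v ≠ .cross i r ∧ v ∈ S) ∨ (v = .cross i r ∧ x ∈ S)}
    (.inl ⟨Ne.symm hne, hS⟩) (by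
      intro a c hac ha
      by_cases he : s(a, c) = s(.cross i r, x)
      · rcases Sym2.eq_iff.1 he with ⟨rfl, rfl⟩ | ⟨rfl, rfl⟩
        · exact .inl ⟨hx0, (ha.resolve_left fun h => h.1 rfl).2⟩
        · exact .inr ⟨rfl, (ha.resolve_right fun h => hx0 h.1).2⟩
      · have ha' : a ≠ .cross i r := fun h => he (hinc _ hac (by simp [h]))
        have hc' : c ≠ .cross i r := fun h => he (hinc _ hac (by simp [h]))
        exact .inl ⟨hc', hcl a c hac he (ha.resolve_right fun h => ha' h.1).2⟩) hv
  refine (hsub.resolve_right ?_).2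
  rintro ⟨rfl, -⟩
  rcases hv with h | ⟨_, _, _, _, h⟩
  · exact hne h
  · cases h

open Classical in
/-- A doubled subaisle with an adjacent horizontal edge can be traded for the subaisle of the
neighbouring aisle. -/
theorem IsOptimal.swap {i j : Fin n} {k : Fin b} {r r' : Fin (b + 1)} (hT : W.IsOptimal T)
    (hd : (i, k) ∈ W.doubled T) (hij : Consecutive i j) (hr : IsEnds k r r')
    (hh : W.horiz i j r ∈ T) :
    T.count (W.horiz i j r) = 1 ∧
      ∃ T', W.IsOptimal T' ∧ (j, k) ∈ W.doubled T' ∧ W.horiz i j r ∉ T' := by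
  have hcount : ∀ e ∈ W.segment i k, T.count e = 2 := fun e he =>
    le_antisymm (hT.isShort.count_le_two (fun e => edgeLength_pos) e) (hd e he)
  -- `R` keeps the second copy of the subaisle, which connectivity relies on below.
  obtain ⟨R, hR⟩ : ∃ R, T = R + ((W.segment i k).val + {W.horiz i j r}) := by
    suffices (W.segment i k).val + {W.horiz i j r} ≤ T by
      obtain ⟨R, hR⟩ := Multiset.le_iff_exists_add.1 this
      exact ⟨R, hR.trans (add_comm _ _)⟩
    rw [Multiset.le_iff_subset]
    · intro e he
      rcases Multiset.mem_add.1 he with he | he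
      · exact Multiset.count_pos.1 (by rw [hcount e he]; norm_num)
      · rwa [Multiset.mem_singleton.1 he]
    · rw [Multiset.nodup_add]
      refine ⟨Finset.nodup _, Multiset.nodup_singleton _, ?_⟩
      rw [Multiset.disjoint_singleton]
      exact horiz_notMem_segment hij.ne
  have hcT : ∀ e, T.count e = R.count e + (if e ∈ W.segment i k then 1 else 0) +
      (if e = W.horiz i j r then 1 else 0) := by
    intro e
    rw [hR, Multiset.count_add, Multiset.count_add, Multiset.count_singleton,
      Multiset.count_eq_of_nodup (Finset.nodup _), add_assoc]
    rfl
  have hEi : ∀ e ∈ W.segment i k, R.count e = 1 := by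
    intro e he
    have h1 := hcount e he
    have h2 : e ≠ W.horiz i j r := fun h => horiz_notMem_segment hij.ne (h ▸ he)
    rw [hcT, if_pos he, if_neg h2] at h1
    omega
  have hEiR : ∀ e ∈ W.segment i k, e ∈ R := fun e he =>
    Multiset.count_pos.1 (by rw [hEi e he]; norm_num)
  set T' := R + ((W.segment j k).val + {W.horiz i j r'}) with hT'
  have hcT' : ∀ e, T'.count e = R.count e + (if e ∈ W.segment j k then 1 else 0) +
      (if e = W.horiz i j r' then 1 else 0) := by
    intro e
    rw [hT', Multiset.count_add, Multiset.count_add, Multiset.count_singleton,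
      Multiset.count_eq_of_nodup (Finset.nodup _), add_assoc]
    rfl
  have hRT' : ∀ e ∈ R, e ∈ T' := fun e he => Multiset.mem_add.2 (.inl he)
  have hEjT' : ∀ e ∈ W.segment j k, e ∈ T' := fun e he =>
    Multiset.mem_add.2 (.inr (Multiset.mem_add.2 (.inl he)))
  have hhT' : W.horiz i j r' ∈ T' := by simp [hT']
  have hpre : IsPretour W.graph W.depot {v | W.IsPickLocation v} T' := by
    refine ⟨fun e he => ?_, fun χ => ?_, fun S hS hcl => hT.isShort.subset S hS ?_⟩
    · rw [hT', Multiset.mem_add, Multiset.mem_add, Multiset.mem_singleton] at he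
      rcases he with he | he | rfl
      · exact hT.isShort.mem_edgeSet e (hR ▸ Multiset.mem_add.2 (.inl he))
      · exact segment_subset_edgeSet he
      · exact W.horiz_adj hij r'
    · have h0 := hT.isShort.even χ
      have h2 : (2 : ZMod 2) = 0 := rfl
      rw [hR] at h0
      rw [hT']
      simp only [Multiset.map_add, Multiset.sum_add, Multiset.map_singleton,
        Multiset.sum_singleton, W.sum_coboundary_segment χ _ hr, horiz, coboundary_mk] at h0 ⊢
      linear_combination h0 + (χ (.cross j r') - χ (.cross i r)) * h2
    · have hiff : Vertex.cross i r ∈ S ↔ Vertex.cross j r ∈ S := by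
        rw [cross_mem_iff_of_segment hr fun a c hac => hcl a c (hRT' _ (hEiR _ hac)),
          cross_mem_iff_of_segment hr fun a c hac => hcl a c (hEjT' _ hac)]
        exact ⟨hcl _ _ hhT', hcl _ _ (by rwa [Sym2.eq_swap])⟩
      intro a c hac
      rw [hR, Multiset.mem_add, Multiset.mem_add, Multiset.mem_singleton] at hac
      rcases hac with h | h | h
      · exact hcl a c (hRT' _ h)
      · exact hcl a c (hRT' _ (hEiR _ h))
      · rcases Sym2.eq_iff.1 h with ⟨rfl, rfl⟩ | ⟨rfl, rfl⟩
        · exact hiff.1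
        · exact hiff.2
  have hshort : W.IsShort T' := by
    refine ⟨hpre, fun T'' h => le_of_eq_of_le ?_ (hT.isShort.le T'' h)⟩
    rw [hR, hT']
    simp only [Multiset.map_add, Multiset.sum_add, Multiset.map_singleton,
      Multiset.sum_singleton, sum_edgeLength_segment, edgeLength_horiz]
  -- The exchange leaves one copy of `(i, k)`, and only `(j, k)` can become doubled.
  have hsub : W.doubled T' ⊆ insert (j, k) (W.doubled T \ {(i, k)}) := by
    rintro ⟨l, m⟩ hlm
    by_cases hj : (l, m) = (j, k)
    · exact .inl hj
    refine .inr ⟨fun e he => ?_, ?_⟩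
    · refine (hlm e he).trans ?_
      have h1 : e ∉ W.segment j k := fun h => hj (by
        obtain ⟨rfl, rfl⟩ := eq_of_mem_segment he h
        rfl)
      have h2 : e ≠ W.horiz i j r' := fun h => horiz_notMem_segment hij.ne (h ▸ he)
      rw [hcT', hcT, if_neg h1, if_neg h2]
      omega
    · intro hi
      obtain ⟨rfl, rfl⟩ := Prod.mk.inj (Set.mem_singleton_iff.1 hi)
      obtain ⟨e, he⟩ := W.segment_nonempty l m
      have h1 : e ∉ W.segment j m := fun h => hj (by rw [(eq_of_mem_segment he h).1])
      have h2 : e ≠ W.horiz l j r' := fun h => horiz_notMem_segment hij.ne (h ▸ he)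
      have h3 := hlm e he
      rw [hcT', if_neg h1, if_neg h2, hEi e he] at h3
      omega
  have hncard : (W.doubled T \ {(i, k)}).ncard < (W.doubled T).ncard :=
    Set.ncard_sdiff_singleton_lt_of_mem hd
  -- Otherwise the number of doubled subaisles would have dropped.
  have hjk : (j, k) ∈ W.doubled T' := by
    by_contra hjk
    refine (hT.ncard_le T' hshort).not_gt (lt_of_le_of_lt (Set.ncard_le_ncard ?_) hncard)
    intro x hx
    refine (hsub hx).resolve_left ?_
    rintro rfl
    exact hjk hx
  have hopt : W.IsOptimal T' := by
    refine ⟨hshort, fun T'' h => le_trans ?_ (hT.ncard_le T'' h)⟩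
    refine (Set.ncard_le_ncard hsub).trans ((Set.ncard_insert_le _ _).trans ?_)
    omega
  -- A further copy of the edge would complete the rectangle in `T'`, so an edge of the doubled
  -- subaisle `(j, k)` would not be a bridge.
  have hhR : W.horiz i j r ∉ R := by
    intro hhR
    obtain ⟨x, p, hx, hp, -⟩ := W.exists_first_edge j hr
    have hxi : ∀ e ∈ W.segment i k, e ≠ s(.cross j r, x) := fun e he h =>
      hij.ne (eq_of_mem_segment he (h ▸ hx)).1
    have hxh : ∀ q, W.horiz i j q ≠ s(.cross j r, x) := fun q h =>
      horiz_notMem_segment hij.ne (h ▸ hx)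
    refine hshort.not_subset_of_two_le_count (fun e => edgeLength_pos) (hjk _ hx)
      fun S hS hcl => hpre.subset S hS fun a c hac => ?_
    by_cases he : s(a, c) = s(.cross j r, x)
    · have hiff : Vertex.cross j r ∈ S ↔ x ∈ S := by
        rw [mem_iff_of_walk p fun a c hac => hcl a c (hEjT' _ (hp _ hac).1) (hp _ hac).2]
        have h1 := cross_mem_iff_of_segment (S := S) hr fun a c hac =>
          hcl a c (hRT' _ (hEiR _ hac)) (hxi _ hac)
        have h2 : Vertex.cross i r ∈ S ↔ Vertex.cross j r ∈ S :=
          ⟨hcl _ _ (hRT' _ hhR) (hxh r), hcl _ _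
            (by rw [Sym2.eq_swap]; exact hRT' _ hhR) (by rw [Sym2.eq_swap]; exact hxh r)⟩
        have h3 : Vertex.cross i r' ∈ S ↔ Vertex.cross j r' ∈ S :=
          ⟨hcl _ _ hhT' (hxh r'), hcl _ _
            (by rwa [Sym2.eq_swap]) (by rw [Sym2.eq_swap]; exact hxh r')⟩
        rw [← h2, h1, h3]
      rcases Sym2.eq_iff.1 he with ⟨rfl, rfl⟩ | ⟨rfl, rfl⟩
      · exact hiff.1
      · exact hiff.2
    · exact hcl a c hac he
  refine ⟨?_, T', hopt, hjk, ?_⟩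
  · rw [hcT, if_neg (horiz_notMem_segment hij.ne), if_pos rfl,
      Multiset.count_eq_zero_of_notMem hhR]
  · rw [hT', Multiset.mem_add, Multiset.mem_add, Multiset.mem_singleton]
    rintro (h | h | h)
    · exact hhR h
    · exact horiz_notMem_segment hij.ne h
    · exact W.horiz_ne_horiz hr.ne h

end Warehouse

end Picker

/-! ### Doubled subaisles, the depot, and the two cases -/

namespace Picker

namespace Warehouse

open Layout

variable {n b : ℕ} {W : Warehouse n b} {T : Multiset (Sym2 W.Vertex)}

/-- Parity at the outer intersection: the subaisle contributes multiplicity 2 and, by `swap`, the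
given horizontal edge contributes 1, so another horizontal edge is odd. -/
theorem IsOptimal.exists_ne_horiz_mem {i j : Fin n} {k : Fin b} {r r' : Fin (b + 1)}
    (hT : W.IsOptimal T) (hd : (i, k) ∈ W.doubled T) (hr : IsEnds k r r')
    (hout : ∀ l s, IsEnds l r s → l = k) (hij : Consecutive i j) (hh : W.horiz i j r ∈ T) :
    ∃ j', j' ≠ j ∧ Consecutive i j' ∧ W.horiz i j' r ∈ T := by
  classical
  obtain ⟨e, hne, hcob, hodd⟩ := hT.isShort.exists_odd_count
    (χ := Pi.single (.cross i r) 1) (e := W.horiz i j r) (by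
      have : Vertex.cross j r ≠ (Vertex.cross i r : W.Vertex) := (W.horiz_adj hij r).ne'
      rw [horiz, coboundary_mk, Pi.single_eq_same, Pi.single_eq_of_ne this]
      decide) (by rw [(hT.swap hd hij hr hh).1]; decide)
  have heT : e ∈ T := Multiset.count_pos.1 hodd.pos
  have hie := mem_of_coboundary_single_ne_zero hcob
  rcases mem_edgeSet_graph (hT.isShort.mem_edgeSet e heT) with ⟨l, m, h⟩ | ⟨l, m, q, h, rfl⟩
  · obtain ⟨rfl, s, hs⟩ := eq_of_cross_mem_segment h hie
    obtain rfl := hout _ _ hs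
    rw [le_antisymm (hT.isShort.count_le_two (fun e => edgeLength_pos) e) (hd e h)] at hodd
    exact absurd hodd (by decide)
  · rcases Sym2.mem_iff.1 hie with h1 | h1 <;> obtain ⟨rfl, rfl⟩ := Vertex.cross.inj h1
    · exact ⟨m, fun h => hne (by rw [h]), h, heT⟩
    · rw [horiz_comm] at heT hne
      exact ⟨l, fun h => hne (by rw [h]), h.symm, heT⟩

/-- After the exchange the edge from `j` back to `i` is gone. Horizontal edges at this end would
have to lead to two different aisles, but `j` has at most one neighbour besides `i`. So there are
none, and the dead end is the depot. -/
theorem IsOptimal.cross_eq_depot_of_horiz_mem {i j : Fin n} {k : Fin b} {r r' : Fin (b + 1)}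
    (hT : W.IsOptimal T) (hd : (i, k) ∈ W.doubled T) (hr : IsEnds k r r')
    (hout : ∀ l s, IsEnds l r s → l = k) (hij : Consecutive i j) (hh : W.horiz i j r ∈ T) :
    .cross j r = W.depot := by
  obtain ⟨-, T', hT', hd', hh'⟩ := hT.swap hd hij hr hh
  refine hT'.isShort.cross_eq_depot hd' hr hout fun l hjl hl => ?_
  obtain ⟨l', hne, hjl', hl'⟩ := hT'.exists_ne_horiz_mem hd' hr hout hjl hl
  rw [horiz_comm] at hh'
  have h1 : l ≠ i := by
    rintro rfl
    exact hh' hl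
  have h2 : l' ≠ i := by
    rintro rfl
    exact hh' hl'
  rw [Ne, Fin.ext_iff] at h1 h2 hne
  unfold Consecutive at hij hjl hjl'
  omega

/-- In an optimal pretour, a doubled subaisle that ends at an outer cross-aisle ends at the
depot. -/
theorem IsOptimal.cross_eq_depot {i : Fin n} {k : Fin b} {r r' : Fin (b + 1)}
    (hT : W.IsOptimal T) (hd : (i, k) ∈ W.doubled T) (hr : IsEnds k r r')
    (hout : ∀ l s, IsEnds l r s → l = k) : .cross i r = W.depot := by
  refine hT.isShort.cross_eq_depot hd hr hout fun j hij hh => ?_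
  obtain ⟨j', hne, hij', hh'⟩ := hT.exists_ne_horiz_mem hd hr hout hij hh
  have h1 := hT.cross_eq_depot_of_horiz_mem hd hr hout hij hh
  have h2 := hT.cross_eq_depot_of_horiz_mem hd hr hout hij' hh'
  exact hne (Vertex.cross.inj (h2.trans h1.symm)).1

/-- An exchange at either end `q` would move the doubled subaisle to aisle `j`, and the depot would
have to be at cross-aisle `r` of both aisles. -/
theorem IsOptimal.horiz_notMem {i j : Fin n} {k : Fin b} {r r' q q' : Fin (b + 1)}
    (hT : W.IsOptimal T) (hd : (i, k) ∈ W.doubled T) (hr : IsEnds k r r')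
    (hout : ∀ l s, IsEnds l r s → l = k) (hq : IsEnds k q q') (hij : Consecutive i j) :
    W.horiz i j q ∉ T := by
  intro hh
  obtain ⟨-, T', hT', hd', -⟩ := hT.swap hd hij hq hh
  have h1 := hT.cross_eq_depot hd hr hout
  have h2 := hT'.cross_eq_depot hd' hr hout
  exact hij.ne (Vertex.cross.inj (h1.trans h2.symm)).1

open Classical in
/-- If the edge `s(t, t')` of the depot's aisle is not doubled and no horizontal edges are used on
the depot's side of it, then all pick locations lie in this aisle. -/
theorem IsShort.aisle_eq {i : Fin n} {t t' : W.Vertex} (hT : W.IsShort T)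
    (ht : W.VertStep t t') (hi : t.aisle = i) (hcount : T.count s(t, t') < 2)
    (hdepot : W.depot.aisle = i)
    (hhor : ∀ r j, Consecutive i j → W.horiz i j r ∈ T →
      ¬ (W.crossPos r ≤ t.pos ↔ W.depot.pos ≤ t.pos))
    {v : W.Vertex} (hv : W.IsPickLocation v) : v.aisle = i := by
  -- The part of aisle `i` on the depot's side of `s(t, t')`; the equivalence treats a depot above
  -- and below the edge alike.
  set S : Set W.Vertex := {v | v.aisle = i ∧ (v.pos ≤ t.pos ↔ W.depot.pos ≤ t.pos)} with hS
  have hcut : ∀ e ∈ T, ∀ a c, e = s(a, c) → a ∈ S → c ∉ S → e = s(t, t') := by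
    rintro e he a c rfl ha hc
    have key : ∀ x y, W.VertStep x y → x.aisle = i → (x ∈ S ↔ y ∉ S) → s(x, y) = s(t, t') := by
      intro x y hxy hxi hiff
      have hyi : y.aisle = i := hxy.1.symm.trans hxi
      have h1 : x.pos ≤ t.pos ∧ t.pos < y.pos := by
        have := hxy.2.1
        have h3 : y.pos ≤ t.pos → x.pos ≤ t.pos := fun h => hxy.2.1.le.trans h
        rw [hS] at hiff
        simp only [Set.mem_ofPred_eq, hxi, hyi, true_and] at hiff
        rw [← not_le]
        tauto
      have h2 : x = t := by
        refine Vertex.ext_pos (hxi.trans hi.symm) (h1.1.eq_of_not_lt fun h => ?_)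
        exact hxy.2.2 t (hi.trans hxi.symm) ⟨h, h1.2⟩
      subst h2
      have h3 : ¬ y.pos < t'.pos := fun h => ht.2.2 y hxy.1.symm ⟨hxy.2.1, h⟩
      have h4 : ¬ t'.pos < y.pos := fun h => hxy.2.2 t' ht.1.symm ⟨ht.2.1, h⟩
      rw [Vertex.ext_pos (hxy.1.symm.trans ht.1) (le_antisymm (not_lt.1 h4) (not_lt.1 h3))]
    rcases mem_edgeSet_graph (hT.mem_edgeSet _ he) with ⟨l, m, h⟩ | ⟨l, m, q, h, hh⟩
    · obtain ⟨x, y, hxy, -, -, -, hac⟩ := mem_segment.1 h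
      rw [hac]
      rcases Sym2.eq_iff.1 hac with ⟨rfl, rfl⟩ | ⟨rfl, rfl⟩
      · exact key _ _ hxy ha.1 (by tauto)
      · exact key _ _ hxy (hxy.1.trans ha.1) (by tauto)
    · exfalso
      rw [hh] at he
      rcases Sym2.eq_iff.1 hh with ⟨rfl, rfl⟩ | ⟨rfl, rfl⟩
      · obtain rfl : l = i := ha.1
        exact hhor q m h he ha.2
      · obtain rfl : m = i := ha.1
        exact hhor q l h.symm (by rwa [horiz_comm]) ha.2
  have hdS : W.depot ∈ S := ⟨hdepot, Iff.rfl⟩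
  refine (hT.subset S hdS (fun a c hac ha => ?_) hv).1
  by_contra hc
  have he := hcut _ hac a c rfl ha hc
  -- A used exit has multiplicity exactly 1, so the even cut needs a second odd edge, but `hcut`
  -- allows only this one.
  have hodd : Odd (T.count s(a, c)) := by
    have := Multiset.count_pos.2 hac
    rw [he] at this ⊢
    rw [show T.count s(t, t') = 1 by omega]
    exact odd_one
  obtain ⟨e', hne, hcob, hodd'⟩ := hT.exists_odd_count (χ := S.indicator 1) (e := s(a, c))
    (by simp [ha, hc]) hodd
  have heT : e' ∈ T := Multiset.count_pos.1 hodd'.pos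
  apply hne
  rw [he]
  induction e' with | _ x y
  by_cases hx : x ∈ S <;> by_cases hy : y ∈ S
  · simp [hx, hy, CharTwo.add_self_eq_zero] at hcob
  · exact hcut _ heT x y rfl hx hy
  · exact hcut _ heT y x Sym2.eq_swap hy hx
  · simp [hx, hy] at hcob

theorem IsOptimal.noDoubleEdge_of_one_block {W : Warehouse n 1} {T : Multiset (Sym2 W.Vertex)}
    (hT : W.IsOptimal T) : W.NoDoubleEdge T := by
  by_contra h
  obtain ⟨i, k, hd⟩ := exists_mem_doubled h
  have hk : IsEnds k k.castSucc k.succ := .inl ⟨rfl, rfl⟩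
  have h1 := hT.cross_eq_depot hd hk fun l s _ => Subsingleton.elim _ _
  have h2 := hT.cross_eq_depot hd hk.symm fun l s _ => Subsingleton.elim _ _
  exact hk.ne (Vertex.cross.inj (h1.trans h2.symm)).2

theorem IsOptimal.noDoubleEdge_of_two_blocks {W : Warehouse n 2} {T : Multiset (Sym2 W.Vertex)}
    (hT : W.IsOptimal T) {i₁ i₂ : Fin n} (hne : i₁ ≠ i₂) (h₁ : W.NonemptyAisle i₁)
    (h₂ : W.NonemptyAisle i₂) : W.NoDoubleEdge T := by
  classical
  by_contra h
  obtain ⟨i, k, hd⟩ := exists_mem_doubled h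
  -- `l` is the other block, `r` and `r'` are the outer cross-aisles of `k` and `l`, and 1 is the
  -- middle one; `hside` records whether `l` lies below or above `k`.
  obtain ⟨l, r, r', hk, hl, hr, hr', hlr, hside⟩ : ∃ (l : Fin 2) (r r' : Fin 3), IsEnds k r 1 ∧
      IsEnds l r' 1 ∧ (∀ m s, IsEnds m r s → m = k) ∧ (∀ m s, IsEnds m r' s → m = l) ∧
      (∀ q, q = r ∨ q = 1 ∨ q = r') ∧
      (r ≤ l.castSucc ∧ r' = l.succ ∨ l.succ ≤ r ∧ r' = l.castSucc) := by
    unfold IsEnds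
    fin_cases k
    · exact ⟨1, 0, 2, by decide⟩
    · exact ⟨0, 2, 0, by decide⟩
  have hrr : r ≠ r' := by
    rintro rfl
    rcases hside with ⟨h1, h2⟩ | ⟨h1, h2⟩ <;> rw [h2, Fin.le_def] at h1 <;> simp at h1
  have h0 := hT.cross_eq_depot hd hk hr
  have hld : (i, l) ∉ W.doubled T := fun hld =>
    hrr (Vertex.cross.inj (h0.trans (hT.cross_eq_depot hld hl hr').symm)).2
  simp only [doubled, Set.mem_ofPred_eq, not_forall, not_le] at hld
  obtain ⟨e, he, hlt⟩ := hld
  obtain ⟨t, t', ht, hti, h3, h4, rfl⟩ := mem_segment.1 he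
  have hall : ∀ {v : W.Vertex}, W.IsPickLocation v → v.aisle = i := by
    intro v hv
    refine hT.isShort.aisle_eq ht hti hlt (by rw [← h0]; rfl) (fun q j hij hq => ?_) hv
    rcases hlr q with rfl | rfl | rfl
    · exact absurd hq (hT.horiz_notMem hd hk hr hk hij)
    · exact absurd hq (hT.horiz_notMem hd hk hr hk.symm hij)
    -- Only cross-aisle `r'` may carry horizontal edges at aisle `i`, and the edge `s(t, t')`
    -- separates it from the depot.
    · have hstep := ht.2.1
      rw [← h0, Vertex.pos]
      rcases hside with ⟨h5, rfl⟩ | ⟨h5, rfl⟩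
      · have h6 := (W.crossPos_strictMono.monotone h5).trans h3
        exact fun h => (h.2 h6).not_gt (hstep.trans_le h4)
      · have h6 := (hstep.trans_le h4).trans_le (W.crossPos_strictMono.monotone h5)
        exact fun h => (h.1 h3).not_gt h6
  obtain ⟨v, hv, rfl⟩ := h₁
  obtain ⟨v', hv', rfl⟩ := h₂
  exact hne ((hall hv).trans (hall hv').symm)

end Warehouse

end Picker

theorem mainTheorem2 :
    (∀ (n : ℕ) (W : Picker.Warehouse n 1),
      ∃ T, W.IsMinimalTour T ∧ W.NoDoubleEdge T) ∧
    (∀ (n : ℕ) (W : Picker.Warehouse n 2),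
      (∃ i j : Fin n, i ≠ j ∧ W.NonemptyAisle i ∧ W.NonemptyAisle j) →
      ∃ T, W.IsMinimalTour T ∧ W.NoDoubleEdge T) := by
  refine ⟨fun n W => ?_, fun n W ⟨i, j, hne, hi, hj⟩ => ?_⟩
  · obtain ⟨T, hT⟩ := W.exists_isOptimal
    exact ⟨T, Picker.Warehouse.isMinimalTour_of_isShort hT.isShort, hT.noDoubleEdge_of_one_block⟩
  · obtain ⟨T, hT⟩ := W.exists_isOptimal
    exact ⟨T, Picker.Warehouse.isMinimalTour_of_isShort hT.isShort,
      hT.noDoubleEdge_of_two_blocks hne hi hj⟩
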